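/- **Setting.** For integers $d,n\ge 1$ and $\boldsymbol\theta=(v_j,\mathbf w_j,b_j)_{j=1}^n\in(\mathbb R\times\mathbb R^d\times\mathbb R)^n$ let $N_{\boldsymbol\theta}(\mathbf x)=\sum_{j=1}^n v_j\,\sigma(\mathbf w_j\cdot\mathbf x+b_j)$ with $\sigma(z)=\max\{0,z\}$, and $\|\boldsymbol\theta\|^2=\sum_{j=1}^n(\|\mathbf w_j\|^2+v_j^2+b_j^2)$. Let $\mathcal D$ be the law of a pair $(\mathbf x,y)$ where $\mathbf x\sim\mathrm{Unif}(\mathbb S^{d-1})$ and, independently of $\mathbf x$, $y=1$ with probability $1-p$ and $y=-1$ with probability $p$. The clean test error is $L_{\mathrm{cl}}(N_{\boldsymbol\theta})=\Pr_{\mathbf x\sim\mathrm{Unif}(\mathbb S^{d-1})}[N_{\boldsymbol\theta}(\mathbf x)\le 0]$. Given a sample $S=(\mathbf x_i,y_i)_{i=1}^m$, the margin maximization problem is $$\min_{\boldsymbol\theta}\ \|\boldsymbol\theta\|^2\quad\text{s.t.}\quad y_iN_{\boldsymbol\theta}(\mathbf x_i)\ge 1\ \text{ for all } i\in\{1,\dots,m\}.\qquad(\ast)$$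 A max-margin solution is a global minimizer of $(\ast)$. A KKT point of $(\ast)$ is a $\boldsymbol\theta$ for which there are $\lambda_1,\dots,\lambda_m\ge 0$ with $\boldsymbol\theta=\sum_{i=1}^m\lambda_iy_i\nabla_{\boldsymbol\theta}N_{\boldsymbol\theta}(\mathbf x_i)$, and with $y_iN_{\boldsymbol\theta}(\mathbf x_i)\ge 1$ and $\lambda_i(y_iN_{\boldsymbol\theta}(\mathbf x_i)-1)=0$ for all $i$; here each derivative of $\sigma$ at $0$ that enters a gradient may be any number in $[0,1]$. **Theorem.** There are universal constants $c_1,c_2,c_3,c_4>0$ such that the following holds. Let $\epsilon,\delta>0$, $p>0$, let $m,n$ be positive integers and let $d\ge 2$ be an integer, with $$p\le c_1,\qquad m\ge c_2\,\frac{\log(1/\delta)}{p},\qquad d\ge c_3\,m^2\log\!\left(\frac m\epsilon\right)\log\!\left(\frac m\delta\right).$$ Then, with probability at least $1-\delta$ over $S\sim\mathcal D^m$, every KKT point $\boldsymbol\theta$ of $(\ast)$ such that $\|\boldsymbol\theta\|^2\le\frac{c_4}{\sqrt p}\|\boldsymbol\theta^*\|^2$, where $\boldsymbol\theta^*$ is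 a max-margin solution of $(\ast)$, satisfies $L_{\mathrm{cl}}(N_{\boldsymbol\theta})\le\epsilon$. -/

import Mathlib

open MeasureTheory

noncomputable section

/-- The inputs live in the Euclidean space `ℝ^d`. -/
abbrev Input (d : ℕ) : Type := EuclideanSpace ℝ (Fin d)

/-- The uniform probability measure on the unit sphere of `ℝ^d`, as a measure on `ℝ^d`: the
normalized surface measure of the sphere, pushed forward along the inclusion. (For `d = 0` the
sphere is empty and this is the zero measure.) -/
def uniformSphere (d : ℕ) : Measure (Input d) :=
  (((volume : Measure (Input d)).toSphere Set.univ)⁻¹ •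
    (volume : Measure (Input d)).toSphere).map Subtype.val

/-- The law of a noisy label: `1` with probability `1 - p` and `-1` with probability `p`. -/
def noisyLabel (p : ℝ) : Measure ℝ :=
  ENNReal.ofReal (1 - p) • Measure.dirac 1 + ENNReal.ofReal p • Measure.dirac (-1)

/-- A labelled data set with `m` examples. -/
abbrev Dataset (d m : ℕ) : Type := Fin m → Input d × ℝ

/-- The law of `m` i.i.d. examples: the input is uniform on the sphere and the label is an
independent noisy label. -/
def sampleLaw (d m : ℕ) (p : ℝ) : Measure (Dataset d m) :=
  Measure.pi fun _ => (uniformSphere d).prod (noisyLabel p)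

/-- The parameters `(v_j, w_j, b_j)_{j = 1, …, n}` of a two-layer network of width `n`. -/
structure NetParams (d n : ℕ) where
  v : Fin n → ℝ
  w : Fin n → Input d
  b : Fin n → ℝ

/-- The ReLU function. -/
def relu (z : ℝ) : ℝ := max 0 z

/-- The derivatives (subgradients) of the ReLU function at `z`: the derivative where it exists, and
every value in `[0, 1]` at the kink `z = 0`. -/
def reluDeriv (z : ℝ) : Set ℝ :=
  {s | (0 < z → s = 1) ∧ (z < 0 → s = 0) ∧ 0 ≤ s ∧ s ≤ 1}

namespace NetParams

variable {d n : ℕ}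

/-- The squared Euclidean norm of the vector of all parameters. -/
def normSq (θ : NetParams d n) : ℝ := ∑ j, (‖θ.w j‖ ^ 2 + θ.v j ^ 2 + θ.b j ^ 2)

/-- The value `w_j · x + b_j` that enters the `j`-th neuron. -/
def preact (θ : NetParams d n) (x : Input d) (j : Fin n) : ℝ := inner ℝ (θ.w j) x + θ.b j

/-- The network `N_θ(x) = ∑_j v_j σ(w_j · x + b_j)`. -/
def net (θ : NetParams d n) (x : Input d) : ℝ := ∑ j, θ.v j * relu (θ.preact x j)

/-- `g` is a (generalized) gradient at `θ` of the map `θ ↦ N_θ(x)`, each derivative of the ReLU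
function at its kink being any number in `[0, 1]`. -/
def IsNetGradient (θ : NetParams d n) (x : Input d) (g : NetParams d n) : Prop :=
  ∃ s : Fin n → ℝ, ∀ j, s j ∈ reluDeriv (θ.preact x j) ∧
    g.v j = relu (θ.preact x j) ∧ g.w j = (θ.v j * s j) • x ∧ g.b j = θ.v j * s j

/-- The clean test error `Pr_x [N_θ(x) ≤ 0]`, for `x` uniform on the unit sphere. -/
def cleanTestError (θ : NetParams d n) : ℝ := (uniformSphere d).real {x | θ.net x ≤ 0}

variable {m : ℕ}

/-- The constraints `y_i N_θ(x_i) ≥ 1` of the margin maximization problem. -/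
def IsFeasible (S : Dataset d m) (θ : NetParams d n) : Prop :=
  ∀ i, 1 ≤ (S i).2 * θ.net (S i).1

/-- `θ` is a max-margin solution: a global minimizer of `‖θ‖²` under the margin constraints. -/
def IsMaxMargin (S : Dataset d m) (θ : NetParams d n) : Prop :=
  θ.IsFeasible S ∧ ∀ θ' : NetParams d n, θ'.IsFeasible S → θ.normSq ≤ θ'.normSq

/-- `θ` is a KKT point of the margin maximization problem: there are multipliers `l_i` such that
`θ = ∑_i l_i y_i ∇_θ N_θ(x_i)` (stationarity, stated for each block of parameters),
`y_i N_θ(x_i) ≥ 1` (primal feasibility), `l_i ≥ 0` (dual feasibility) and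
`l_i (y_i N_θ(x_i) - 1) = 0` (complementary slackness). -/
def IsKKT (S : Dataset d m) (θ : NetParams d n) : Prop :=
  ∃ (l : Fin m → ℝ) (g : Fin m → NetParams d n),
    (∀ i, θ.IsNetGradient (S i).1 (g i)) ∧
    (∀ j, θ.v j = ∑ i, (l i * (S i).2) * (g i).v j) ∧
    (∀ j, θ.w j = ∑ i, (l i * (S i).2) • (g i).w j) ∧
    (∀ j, θ.b j = ∑ i, (l i * (S i).2) * (g i).b j) ∧
    θ.IsFeasible S ∧
    (∀ i, 0 ≤ l i) ∧
    (∀ i, l i * ((S i).2 * θ.net (S i).1 - 1) = 0)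

end NetParams

end

/-!
At most about `p * m` of the labels are `-1`, and in dimension `d ≫ m ^ 2` the inputs, together with
a fresh test point, are nearly orthogonal. A network with one constant neuron and one neuron
pointing at the sum of the inputs labelled `-1` then fits the sample with squared norm of order
`√(p * m)` (`NetParams.exists_isFeasible_normSq_le`), so the KKT points in question have squared
norm at most a small multiple of `√m`.

Such a network cannot afford to fit the clean labels through the inner products with the inputs:
by near orthogonality `∑ i, |⟪w, x_i⟫|` is at most of order `√m * ‖w‖`, so the linear parts of the
preactivations can raise the network by a constant at a constant fraction of the sample only if the
squared norm is of order `√m`. Hence the network is positive at the origin, by a constant. At a KKT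
point the weights lie in the span of the inputs, so at a test point nearly orthogonal to the inputs
the network is close to its value at the origin, and therefore positive
(`NetParams.IsKKT.net_pos_of_normSq_le`). The exceptional points are controlled by a volume bound
for spherical caps (`uniformSphere_cap_le`), the sample by a union bound and a Chernoff bound.

For `δ` close to `1` the lower bound on `m` leaves room for `p * m` to be arbitrarily small. When
`p * m ≤ δ`, the event that no label is `-1` is likely enough. On it every KKT point, of whatever
norm, is positive almost everywhere, because all of its output weights and multipliers have the same
sign (`NetParams.IsKKT.net_pos_of_forall_label_eq_one`). Otherwise `p * m ≥ 1 / 2`.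
-/

/-! ### Nearly orthonormal families -/

/-- The Gram matrix of a nearly orthonormal family is close to the identity: with inner products
bounded by `η`, a linear combination has the squared norm of its coefficient vector up to the
factor `1 ± η * card ι`. -/
theorem abs_norm_sq_sum_smul_sub_le {ι E : Type*} [Fintype ι] [NormedAddCommGroup E]
    [InnerProductSpace ℝ E] {x : ι → E} {η : ℝ} (hx : ∀ i, ‖x i‖ = 1) (hη : 0 ≤ η)
    (hxη : ∀ i j, i ≠ j → |inner ℝ (x i) (x j)| ≤ η) (c : ι → ℝ) :
    |‖∑ i, c i • x i‖ ^ 2 - ∑ i, c i ^ 2| ≤ η * Fintype.card ι * ∑ i, c i ^ 2 := by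
  classical
  have h₁ : ‖∑ i, c i • x i‖ ^ 2 - ∑ i, c i ^ 2
      = ∑ i, ∑ j, c i * c j * (inner ℝ (x i) (x j) - if i = j then 1 else 0) := by
    rw [← real_inner_self_eq_norm_sq, sum_inner, ← Finset.sum_sub_distrib]
    refine Finset.sum_congr rfl fun i _ ↦ ?_
    simp only [inner_sum, mul_sub, Finset.sum_sub_distrib, mul_ite, mul_one, mul_zero,
      Finset.sum_ite_eq, Finset.mem_univ, if_true, real_inner_smul_left, real_inner_smul_right]
    congr 1
    · exact Finset.sum_congr rfl fun j _ ↦ by ring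
    · ring
  have h₂ : ∀ i j, |c i * c j * (inner ℝ (x i) (x j) - if i = j then 1 else 0)|
      ≤ η * (|c i| * |c j|) := by
    intro i j
    rw [abs_mul, abs_mul, mul_comm]
    refine mul_le_mul_of_nonneg_right ?_ (by positivity)
    by_cases h : i = j
    · subst h
      simp [hx, hη]
    · simpa [h] using hxη i j h
  calc _ ≤ ∑ i, ∑ j, η * (|c i| * |c j|) := by
        rw [h₁]
        refine (Finset.abs_sum_le_sum_abs _ _).trans (Finset.sum_le_sum fun i _ ↦ ?_)
        exact (Finset.abs_sum_le_sum_abs _ _).trans (Finset.sum_le_sum fun j _ ↦ h₂ i j)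
    _ = η * (∑ i, |c i|) ^ 2 := by
        rw [sq, Finset.sum_mul_sum, Finset.mul_sum]
        simp only [Finset.mul_sum]
    _ ≤ η * (Fintype.card ι * ∑ i, c i ^ 2) := by
        refine mul_le_mul_of_nonneg_left ?_ hη
        simpa using sq_sum_le_card_mul_sum_sq (s := Finset.univ) (f := fun i ↦ |c i|)
    _ = _ := by ring

/-- The sum of the `|⟪w, x i⟫|` is at most of order `√(card ι) * ‖w‖`: it is the inner product of
`w` with a signed sum of the nearly orthonormal `x i`. -/
theorem sum_abs_inner_le {ι E : Type*} [Fintype ι] [NormedAddCommGroup E]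
    [InnerProductSpace ℝ E] {x : ι → E} {η : ℝ} (hx : ∀ i, ‖x i‖ = 1) (hη : 0 ≤ η)
    (hxη : ∀ i j, i ≠ j → |inner ℝ (x i) (x j)| ≤ η) (hcard : η * Fintype.card ι ≤ 1) (w : E) :
    ∑ i, |inner ℝ w (x i)| ≤ √(2 * Fintype.card ι) * ‖w‖ := by
  set c : ι → ℝ := fun i ↦ if 0 ≤ inner ℝ w (x i) then 1 else -1 with hc
  have hc₂ : ∀ i, c i ^ 2 = 1 := fun i ↦ by simp only [hc]; split_ifs <;> norm_num
  have h₁ : ∑ i, |inner ℝ w (x i)| = inner ℝ w (∑ i, c i • x i) := by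
    rw [inner_sum]
    refine Finset.sum_congr rfl fun i _ ↦ ?_
    rw [real_inner_smul_right]
    simp only [hc]
    split_ifs with h
    · rw [abs_of_nonneg h, one_mul]
    · rw [abs_of_neg (not_le.1 h), neg_one_mul]
  have h₂ := abs_norm_sq_sum_smul_sub_le hx hη hxη c
  simp only [hc₂, Finset.sum_const, Finset.card_univ, nsmul_eq_mul, mul_one] at h₂
  have h₃ : ‖∑ i, c i • x i‖ ≤ √(2 * Fintype.card ι) := by
    refine Real.le_sqrt_of_sq_le ?_
    have := mul_le_mul_of_nonneg_right hcard (Nat.cast_nonneg (α := ℝ) (Fintype.card ι))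
    linarith [(abs_le.1 h₂).2]
  rw [h₁, mul_comm]
  exact (real_inner_le_norm _ _).trans (mul_le_mul_of_nonneg_left h₃ (norm_nonneg _))

/-- A vector in the span of a nearly orthonormal family is nearly orthogonal to every vector that
is nearly orthogonal to the family. -/
theorem abs_inner_sum_smul_le {ι E : Type*} [Fintype ι] [NormedAddCommGroup E]
    [InnerProductSpace ℝ E] {x : ι → E} {η : ℝ} (hx : ∀ i, ‖x i‖ = 1) (hη : 0 ≤ η)
    (hxη : ∀ i j, i ≠ j → |inner ℝ (x i) (x j)| ≤ η) (hcard : η * Fintype.card ι ≤ 1 / 2)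
    {τ : ℝ} {y : E} (hy : ∀ i, |inner ℝ (x i) y| ≤ τ) (hτ : 0 ≤ τ) (c : ι → ℝ) :
    |inner ℝ (∑ i, c i • x i) y| ≤ τ * √(2 * Fintype.card ι) * ‖∑ i, c i • x i‖ := by
  have h₁ : ∑ i, c i ^ 2 ≤ 2 * ‖∑ i, c i • x i‖ ^ 2 := by
    have h := abs_norm_sq_sum_smul_sub_le hx hη hxη c
    have := mul_le_mul_of_nonneg_right hcard (Finset.sum_nonneg fun i (_ : i ∈ Finset.univ) ↦
      sq_nonneg (c i))
    linarith [(abs_le.1 h).1]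
  have h₂ : ∑ i, |c i| ≤ √(2 * Fintype.card ι) * ‖∑ i, c i • x i‖ := by
    refine abs_le_of_sq_le_sq' ?_ (by positivity) |>.2
    rw [mul_pow, Real.sq_sqrt (by positivity)]
    have h := sq_sum_le_card_mul_sum_sq (s := Finset.univ) (f := fun i ↦ |c i|)
    simp only [sq_abs, Finset.card_univ] at h
    nlinarith [mul_le_mul_of_nonneg_left h₁ (Nat.cast_nonneg (α := ℝ) (Fintype.card ι))]
  calc |inner ℝ (∑ i, c i • x i) y| ≤ ∑ i, |c i| * τ := by
        rw [sum_inner]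
        refine (Finset.abs_sum_le_sum_abs _ _).trans (Finset.sum_le_sum fun i _ ↦ ?_)
        rw [real_inner_smul_left, abs_mul]
        exact mul_le_mul_of_nonneg_left (hy i) (abs_nonneg _)
    _ = τ * ∑ i, |c i| := by rw [← Finset.sum_mul, mul_comm]
    _ ≤ τ * (√(2 * Fintype.card ι) * ‖∑ i, c i • x i‖) := mul_le_mul_of_nonneg_left h₂ hτ
    _ = _ := by ring

namespace NetParams

variable {d n m : ℕ}

/-! ### Elementary estimates for networks -/

theorem relu_nonneg (z : ℝ) : 0 ≤ relu z := le_max_left _ _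

theorem relu_of_nonneg {z : ℝ} (hz : 0 ≤ z) : relu z = z := max_eq_right hz

theorem relu_of_nonpos {z : ℝ} (hz : z ≤ 0) : relu z = 0 := max_eq_left hz

theorem relu_pos_iff {z : ℝ} : 0 < relu z ↔ 0 < z := by simp [relu]

theorem abs_relu_sub_relu_le (y z : ℝ) : |relu y - relu z| ≤ |y - z| := by
  simpa [relu] using abs_max_sub_max_le_max 0 y 0 z

/-- The ReLU function is `1`-Lipschitz, so the network moves away from its value at the origin by
at most the linear part of the preactivations. -/
theorem abs_net_sub_net_zero_le (θ : NetParams d n) (x : Input d) :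
    |θ.net x - θ.net 0| ≤ ∑ j, |θ.v j| * |inner ℝ (θ.w j) x| := by
  rw [net, net, ← Finset.sum_sub_distrib]
  refine (Finset.abs_sum_le_sum_abs _ _).trans (Finset.sum_le_sum fun j _ ↦ ?_)
  rw [← mul_sub, abs_mul]
  refine mul_le_mul_of_nonneg_left ((abs_relu_sub_relu_le _ _).trans ?_) (abs_nonneg _)
  simp [preact]

theorem sum_abs_mul_norm_le (θ : NetParams d n) :
    ∑ j, |θ.v j| * ‖θ.w j‖ ≤ θ.normSq / 2 := by
  rw [normSq, Finset.sum_div]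
  refine Finset.sum_le_sum fun j _ ↦ ?_
  nlinarith [sq_nonneg (|θ.v j| - ‖θ.w j‖), sq_abs (θ.v j), sq_nonneg (θ.b j)]

/-- The first-layer weights of a KKT point lie in the span of the inputs. -/
theorem IsKKT.exists_w_eq_sum {S : Dataset d m} {θ : NetParams d n} (h : θ.IsKKT S) (j : Fin n) :
    ∃ c : Fin m → ℝ, θ.w j = ∑ i, c i • (S i).1 := by
  obtain ⟨l, g, hg, -, hw, -⟩ := h
  choose s hs using hg
  refine ⟨fun i ↦ l i * (S i).2 * (θ.v j * s i j), ?_⟩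
  rw [hw j]
  refine Finset.sum_congr rfl fun i _ ↦ ?_
  rw [(hs i j).2.2.1, smul_smul]

theorem IsKKT.isFeasible {S : Dataset d m} {θ : NetParams d n} (h : θ.IsKKT S) :
    θ.IsFeasible S := by
  obtain ⟨l, g, -, -, -, -, hf, -⟩ := h
  exact hf

/-! ### Samples without noisy labels -/

/-- If all labels are `1`, then at a KKT point all output weights are nonnegative and every active
neuron is a nonnegative combination of the functions `x ↦ 1 + ⟪x_i, x⟫`, so the network is positive
on the unit sphere away from the antipodes of the inputs. -/
theorem IsKKT.net_pos_of_forall_label_eq_one [NeZero m] {S : Dataset d m} {θ : NetParams d n}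
    (h : θ.IsKKT S) (hS : ∀ i, ‖(S i).1‖ = 1) (hlabel : ∀ i, (S i).2 = 1) {x : Input d}
    (hx : ‖x‖ = 1) (hxS : ∀ i, x ≠ -(S i).1) : 0 < θ.net x := by
  have hfeas := h.isFeasible
  obtain ⟨l, g, hg, hv, hw, hb, -, hl, -⟩ := h
  choose s hs using hg
  simp only [hlabel, mul_one] at hv hw hb
  have hv₀ : ∀ j, 0 ≤ θ.v j := by
    intro j
    rw [hv j]
    refine Finset.sum_nonneg fun i _ ↦ mul_nonneg (hl i) ?_
    rw [(hs i j).2.1]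
    exact relu_nonneg _
  have hpre : ∀ y j, θ.preact y j
      = ∑ i, l i * (θ.v j * s i j) * (1 + inner ℝ (S i).1 y) := by
    intro y j
    rw [preact, hw j, hb j, sum_inner, ← Finset.sum_add_distrib]
    refine Finset.sum_congr rfl fun i _ ↦ ?_
    rw [(hs i j).2.2.1, (hs i j).2.2.2, real_inner_smul_left, real_inner_smul_left]
    ring
  have hcoef : ∀ i j, 0 ≤ l i * (θ.v j * s i j) := fun i j ↦
    mul_nonneg (hl i) (mul_nonneg (hv₀ j) (hs i j).1.2.2.1)
  have hinner : ∀ i, 0 < 1 + inner ℝ (S i).1 x := by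
    intro i
    have h₁ : 0 < ‖x + (S i).1‖ ^ 2 := by
      have : x + (S i).1 ≠ 0 := fun h ↦ hxS i (eq_neg_of_add_eq_zero_left h)
      positivity
    rw [norm_add_sq_real, hx, hS i, real_inner_comm] at h₁
    linarith
  -- Some active neuron with a positive output weight is needed to fit any single example.
  obtain ⟨j, -, hj⟩ : ∃ j ∈ Finset.univ, 0 < θ.v j * relu (θ.preact (S 0).1 j) := by
    refine Finset.exists_lt_of_sum_lt (f := fun _ ↦ (0 : ℝ)) ?_
    have := hfeas 0
    rw [hlabel, one_mul, net] at this
    simp only [Finset.sum_const_zero]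
    linarith
  have hvj : 0 < θ.v j := pos_of_mul_pos_left hj (relu_nonneg _)
  have hact : 0 < θ.preact (S 0).1 j := relu_pos_iff.1 (pos_of_mul_pos_right hj hvj.le)
  obtain ⟨i, hi⟩ : ∃ i, l i * (θ.v j * s i j) ≠ 0 := by
    by_contra! h₀
    rw [hpre] at hact
    simp [h₀] at hact
  have hactx : 0 < θ.preact x j := by
    rw [hpre]
    exact Finset.sum_pos' (fun k _ ↦ mul_nonneg (hcoef k j) (hinner k).le)
      ⟨i, Finset.mem_univ _, mul_pos ((hcoef i j).lt_of_ne' hi) (hinner i)⟩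
  exact Finset.sum_pos' (fun k _ ↦ mul_nonneg (hv₀ k) (relu_nonneg _))
    ⟨j, Finset.mem_univ _, mul_pos hvj (relu_pos_iff.2 hactx)⟩

/-! ### The optimal value of the margin problem -/

/-- If at most `K` of the labels are `-1`, then a constant neuron and one negative neuron, whose
weight is a multiple of the sum of the inputs with label `-1`, fit the data with squared norm of
order `√K`. -/
theorem exists_isFeasible_normSq_le {S : Dataset d m} (hS : ∀ i, ‖(S i).1‖ = 1)
    (hlabel : ∀ i, (S i).2 = 1 ∨ (S i).2 = -1)
    (hinner : ∀ i j, i ≠ j → |inner ℝ (S i).1 (S j).1| ≤ 1 / (4 * m)) {K : ℝ} (hK : 1 ≤ K)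
    (hcount : ∑ i, (1 - (S i).2) / 2 ≤ K) {j k : Fin n} (hjk : j ≠ k) :
    ∃ θ : NetParams d n, θ.IsFeasible S ∧ θ.normSq ≤ 53 * √K := by
  have hη : (0 : ℝ) ≤ 1 / (4 * m) := by positivity
  have hmη : (1 : ℝ) / (4 * m) * m ≤ 1 / 4 := by
    rcases Nat.eq_zero_or_pos m with rfl | hm
    · norm_num
    · have : (0 : ℝ) < m := by exact_mod_cast hm
      exact le_of_eq (by field_simp)
  set c : Fin m → ℝ := fun i ↦ (1 - (S i).2) / 2 with hc
  have hc₀ : ∀ i, c i = 0 ∨ c i = 1 := fun i ↦ by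
    rcases hlabel i with h | h <;> simp [hc, h]
  set u : Input d := ∑ i, c i • (S i).1 with hu
  have hu₁ : ‖u‖ ^ 2 ≤ 5 / 4 * K := by
    have h₁ := abs_norm_sq_sum_smul_sub_le hS hη hinner c
    have h₂ : ∑ i, c i ^ 2 = ∑ i, c i :=
      Finset.sum_congr rfl fun i _ ↦ by rcases hc₀ i with h | h <;> simp [h]
    rw [h₂, Fintype.card_fin] at h₁
    have h₃ : 0 ≤ ∑ i, c i := Finset.sum_nonneg fun i _ ↦ by rcases hc₀ i with h | h <;> simp [h]
    have := mul_le_mul_of_nonneg_right hmη h₃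
    linarith [(abs_le.1 h₁).2]
  have hu₂ : ∀ i, |inner ℝ u (S i).1 - c i| ≤ 1 / 4 := by
    intro i
    have h₁ : inner ℝ u (S i).1 - c i
        = ∑ k, c k * (inner ℝ (S k).1 (S i).1 - if k = i then 1 else 0) := by
      rw [hu, sum_inner]
      simp [mul_sub, Finset.sum_sub_distrib, real_inner_smul_left]
    rw [h₁]
    refine (Finset.abs_sum_le_sum_abs _ _).trans
      ((Finset.sum_le_sum (g := fun _ ↦ (1 : ℝ) / (4 * m)) fun k _ ↦ ?_).trans ?_)
    · have h₂ : |inner ℝ (S k).1 (S i).1 - if k = i then (1 : ℝ) else 0| ≤ 1 / (4 * m) := by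
        by_cases h : k = i
        · subst h
          simp [hS]
        · simpa [h] using hinner k i h
      rw [abs_mul]
      rcases hc₀ k with h | h
      · simp [h]
      · rwa [h, abs_one, one_mul]
    · rw [Finset.sum_const, Finset.card_univ, Fintype.card_fin, nsmul_eq_mul, mul_comm]
      exact hmη
  -- The two layers of the negative neuron are balanced: both contribute order `r ^ 2 = √K`.
  set r : ℝ := √√K with hr
  have hs : 1 ≤ √K := Real.one_le_sqrt.2 hK
  have hsK : √K ^ 2 = K := Real.sq_sqrt (by linarith)
  have hr₀ : 0 < r := Real.sqrt_pos.2 (by linarith)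
  have hr₂ : r ^ 2 = √K := Real.sq_sqrt (by linarith)
  have h2 : √(2 : ℝ) ^ 2 = 2 := Real.sq_sqrt (by norm_num)
  let θ : NetParams d n :=
    { v := fun i ↦ if i = j then √2 else if i = k then -r else 0
      w := fun i ↦ if i = k then (6 / r) • u else 0
      b := fun i ↦ if i = j then √2 else if i = k then -(6 / r * (1 / 4)) else 0 }
  have hnet : ∀ x, θ.net x = 2 - r * relu (6 / r * (inner ℝ u x - 1 / 4)) := by
    intro x
    rw [net, Fintype.sum_eq_add j k hjk]
    · have h₁ : θ.preact x j = √2 := by simp [preact, θ, hjk]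
      have h₂ : θ.preact x k = 6 / r * (inner ℝ u x - 1 / 4) := by
        simp [preact, θ, hjk.symm, real_inner_smul_left]
        ring
      rw [h₁, h₂, relu_of_nonneg (Real.sqrt_nonneg _)]
      simp only [θ, if_true, hjk.symm, if_false]
      linear_combination h2
    · rintro i ⟨hij, hik⟩
      simp [θ, hij, hik]
  refine ⟨θ, fun i ↦ ?_, ?_⟩
  · have hi := abs_le.1 (hu₂ i)
    rw [hnet]
    rcases hlabel i with h | h
    · have hci : c i = 0 := by simp [hc, h]
      rw [relu_of_nonpos (mul_nonpos_of_nonneg_of_nonpos (by positivity) (by linarith [hi.2])), h]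
      norm_num
    · have hci : c i = 1 := by simp only [hc, h]; norm_num
      have : r * (6 / r * (inner ℝ u (S i).1 - 1 / 4)) = 6 * (inner ℝ u (S i).1 - 1 / 4) := by
        field_simp
      rw [relu_of_nonneg (mul_nonneg (by positivity) (by linarith [hi.1])), h, this]
      linarith [hi.1]
  · rw [normSq, Fintype.sum_eq_add j k hjk]
    · simp only [θ, if_true, hjk, hjk.symm, if_false, norm_smul, norm_zero, Real.norm_eq_abs,
        mul_pow, sq_abs, neg_sq, div_pow, h2, hr₂]
      have h₁ : 6 ^ 2 / √K * ‖u‖ ^ 2 ≤ 45 * √K := by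
        rw [div_mul_eq_mul_div, div_le_iff₀ (by linarith)]
        nlinarith
      have h₂ : 6 ^ 2 / √K * (1 ^ 2 / 4 ^ 2) ≤ 9 / 4 * √K := by
        rw [div_mul_eq_mul_div, div_le_iff₀ (by linarith)]
        nlinarith
      linarith
    · rintro i ⟨hij, hik⟩
      simp [θ, hij, hik]

/-- A max-margin solution for a sample with both labels has squared norm of order `√K`, where `K`
bounds the number of labels `-1`. Feasibility forces both signs among the output weights, so there
are two neurons to work with. -/
theorem IsMaxMargin.normSq_le {S : Dataset d m} {θ : NetParams d n} (hθ : θ.IsMaxMargin S)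
    (hS : ∀ i, ‖(S i).1‖ = 1) (hlabel : ∀ i, (S i).2 = 1 ∨ (S i).2 = -1)
    (hinner : ∀ i j, i ≠ j → |inner ℝ (S i).1 (S j).1| ≤ 1 / (4 * m)) {K : ℝ}
    (hcount : ∑ i, (1 - (S i).2) / 2 ≤ K) (hpos : ∃ i, (S i).2 = 1) (hneg : ∃ i, (S i).2 = -1) :
    θ.normSq ≤ 53 * √K := by
  obtain ⟨i, hi⟩ := hpos
  obtain ⟨i', hi'⟩ := hneg
  have hK : 1 ≤ K := by
    refine le_trans ?_ hcount
    have h := Finset.single_le_sum (f := fun i ↦ (1 - (S i).2) / 2) (s := Finset.univ)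
      (fun l _ ↦ by rcases hlabel l with h | h <;> rw [h] <;> norm_num) (Finset.mem_univ i')
    simp only [hi'] at h
    linarith
  have h₁ := hθ.1 i
  have h₂ := hθ.1 i'
  rw [hi, one_mul, net] at h₁
  rw [hi', neg_one_mul, net] at h₂
  obtain ⟨j, -, hj⟩ : ∃ j ∈ Finset.univ, 0 < θ.v j * relu (θ.preact (S i).1 j) := by
    refine Finset.exists_lt_of_sum_lt (f := fun _ ↦ (0 : ℝ)) ?_
    simp only [Finset.sum_const_zero]
    linarith
  obtain ⟨k, -, hk⟩ : ∃ k ∈ Finset.univ, θ.v k * relu (θ.preact (S i').1 k) < 0 := by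
    refine Finset.exists_lt_of_sum_lt (g := fun _ ↦ (0 : ℝ)) ?_
    simp only [Finset.sum_const_zero]
    linarith
  have hvj := pos_of_mul_pos_left hj (relu_nonneg _)
  have hvk := neg_of_mul_neg_left hk (relu_nonneg _)
  obtain ⟨θ', hθ', hle⟩ := exists_isFeasible_normSq_le hS hlabel hinner hK hcount
    (j := j) (k := k) (by rintro rfl; linarith)
  exact (hθ.2 θ' hθ').trans hle

/-! ### KKT points of small norm -/

/-- A KKT point of squared norm at most `√m / 8` is positive at every point that is nearly
orthogonal to the sample, provided that at most half of the labels are `-1`. -/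
theorem IsKKT.net_pos_of_normSq_le [NeZero m] {S : Dataset d m} {θ : NetParams d n}
    (hθ : θ.IsKKT S) (hS : ∀ i, ‖(S i).1‖ = 1) (hlabel : ∀ i, (S i).2 = 1 ∨ (S i).2 = -1)
    (hinner : ∀ i j, i ≠ j → |inner ℝ (S i).1 (S j).1| ≤ 1 / (4 * m))
    (hcount : ∑ i, (1 - (S i).2) / 2 ≤ (m : ℝ) / 2) (hnorm : θ.normSq ≤ √m / 8)
    {x : Input d} (hx : ∀ i, |inner ℝ (S i).1 x| ≤ 1 / m) : 0 < θ.net x := by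
  have hm : (0 : ℝ) < m := by exact_mod_cast NeZero.pos m
  have hη : (0 : ℝ) ≤ 1 / (4 * m) := by positivity
  have hmη : (1 : ℝ) / (4 * m) * m = 1 / 4 := by field_simp
  have hsum : √(2 * m) * ∑ j, |θ.v j| * ‖θ.w j‖ ≤ m / 8 := by
    have h₁ : √(2 * m) ≤ 2 * √(m : ℝ) := by
      rw [Real.sqrt_le_left (by positivity), mul_pow, Real.sq_sqrt hm.le]
      linarith
    calc _ ≤ 2 * √(m : ℝ) * (√m / 8 / 2) :=
          mul_le_mul h₁ (θ.sum_abs_mul_norm_le.trans (by linarith))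
            (Finset.sum_nonneg fun j _ ↦ by positivity) (by positivity)
      _ = √(m : ℝ) ^ 2 / 8 := by ring
      _ = m / 8 := by rw [Real.sq_sqrt hm.le]
  -- The value at the origin is at least `1 / 2`: otherwise the linear parts alone would have to
  -- raise the network by `1 / 2` at half of the sample, which the norm does not allow.
  have hzero : 1 / 2 < θ.net 0 := by
    by_contra! h₀
    have h₁ : ∀ i, (1 - (1 - (S i).2) / 2) * (1 / 2) ≤ |θ.net (S i).1 - θ.net 0| := by
      intro i
      have h := hθ.isFeasible i
      rcases hlabel i with h' | h'
      · rw [h', one_mul] at h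
        rw [h']
        refine le_trans ?_ (le_abs_self _)
        linarith
      · rw [h']
        norm_num
    have h₂ : ∑ i, |θ.net (S i).1 - θ.net 0| ≤ m / 8 := by
      refine le_trans ?_ hsum
      calc _ ≤ ∑ i, ∑ j, |θ.v j| * |inner ℝ (θ.w j) (S i).1| :=
            Finset.sum_le_sum fun i _ ↦ θ.abs_net_sub_net_zero_le _
        _ = ∑ j, |θ.v j| * ∑ i, |inner ℝ (θ.w j) (S i).1| := by
            rw [Finset.sum_comm]
            simp only [Finset.mul_sum]
        _ ≤ ∑ j, |θ.v j| * (√(2 * m) * ‖θ.w j‖) := by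
            refine Finset.sum_le_sum fun j _ ↦ mul_le_mul_of_nonneg_left ?_ (abs_nonneg _)
            simpa using sum_abs_inner_le hS hη hinner
              (by rw [Fintype.card_fin, hmη]; norm_num) (θ.w j)
        _ = _ := by
            rw [Finset.mul_sum]
            exact Finset.sum_congr rfl fun j _ ↦ by ring
    have h₃ := Finset.sum_le_sum fun i (_ : i ∈ Finset.univ) ↦ h₁ i
    rw [← Finset.sum_mul, Finset.sum_sub_distrib, Finset.sum_const, Finset.card_univ,
      Fintype.card_fin, nsmul_eq_mul, mul_one] at h₃
    linarith
  have hlin : |θ.net x - θ.net 0| ≤ 1 / 8 := by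
    calc _ ≤ ∑ j, |θ.v j| * |inner ℝ (θ.w j) x| := θ.abs_net_sub_net_zero_le _
      _ ≤ ∑ j, |θ.v j| * (1 / m * √(2 * m) * ‖θ.w j‖) := by
          refine Finset.sum_le_sum fun j _ ↦ mul_le_mul_of_nonneg_left ?_ (abs_nonneg _)
          obtain ⟨c, hc⟩ := hθ.exists_w_eq_sum j
          rw [hc]
          simpa using abs_inner_sum_smul_le hS hη hinner
            (by rw [Fintype.card_fin, hmη]; norm_num) hx (by positivity) c
      _ = 1 / m * (√(2 * m) * ∑ j, |θ.v j| * ‖θ.w j‖) := by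
          rw [Finset.mul_sum, Finset.mul_sum]
          exact Finset.sum_congr rfl fun j _ ↦ by ring
      _ ≤ 1 / m * (m / 8) := mul_le_mul_of_nonneg_left hsum (by positivity)
      _ = 1 / 8 := by field_simp
  linarith [(abs_le.1 hlin).1]

end NetParams

/-! ### The uniform measure on the sphere -/

/-- The uniform measure of a set on the sphere is the volume of the cone over it, relative to the
volume of the unit ball. -/
theorem uniformSphere_le_of_cone_subset {d : ℕ} (hd : d ≠ 0) {A B : Set (Input d)}
    (hA : MeasurableSet A) (hAB : ∀ r ∈ Set.Ioo (0 : ℝ) 1, ∀ x ∈ A, ‖x‖ = 1 → r • x ∈ B)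
    {c : ENNReal} (hB : volume B ≤ c * volume (Metric.ball (0 : Input d) 1)) :
    uniformSphere d A ≤ c := by
  have hd' : (d : ENNReal) ≠ 0 := by exact_mod_cast hd
  have hball : volume (Metric.ball (0 : Input d) 1) ≠ 0 :=
    (Metric.measure_ball_pos volume _ one_pos).ne'
  have hball' : volume (Metric.ball (0 : Input d) 1) ≠ ⊤ := measure_ball_lt_top.ne
  rw [uniformSphere, Measure.map_apply measurable_subtype_coe hA, Measure.smul_apply,
    Measure.toSphere_apply_univ, Measure.toSphere_apply' _ (measurable_subtype_coe hA),
    finrank_euclideanSpace_fin, smul_eq_mul, ← ENNReal.div_eq_inv_mul]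
  refine ENNReal.div_le_of_le_mul ?_
  rw [mul_left_comm]
  refine mul_le_mul_right ((measure_mono ?_).trans hB) _
  rintro _ ⟨r, hr, _, ⟨x, hx, rfl⟩, rfl⟩
  exact hAB r hr x hx (by simp)

theorem isProbabilityMeasure_uniformSphere {d : ℕ} (hd : d ≠ 0) :
    IsProbabilityMeasure (uniformSphere d) := by
  have : NeZero d := ⟨hd⟩
  refine ⟨?_⟩
  rw [uniformSphere, Measure.map_apply measurable_subtype_coe .univ, Measure.smul_apply,
    Set.preimage_univ, smul_eq_mul]
  exact ENNReal.inv_mul_cancel (Measure.measure_univ_ne_zero.2 (Measure.toSphere_ne_zero _))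
    (measure_ne_top _ _)

theorem ae_uniformSphere_norm_eq_one (d : ℕ) : ∀ᵐ x ∂uniformSphere d, ‖x‖ = 1 := by
  rw [uniformSphere, ae_map_iff measurable_subtype_coe.aemeasurable
    (measurableSet_eq_fun measurable_norm measurable_const)]
  exact Filter.Eventually.of_forall fun x ↦ by simp

/-- The cone over a point lies on a line, which is a null set in dimension at least two. -/
theorem uniformSphere_singleton {d : ℕ} (hd : 2 ≤ d) (y : Input d) : uniformSphere d {y} = 0 := by
  refine le_antisymm (uniformSphere_le_of_cone_subset (B := Submodule.span ℝ {y}) (by omega)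
    (measurableSet_singleton y) ?_ ?_) zero_le
  · rintro r - x rfl -
    exact Submodule.smul_mem _ _ (Submodule.mem_span_singleton_self _)
  · rw [zero_mul, nonpos_iff_eq_zero]
    refine Measure.addHaar_submodule _ _ fun h ↦ ?_
    have h₁ := finrank_span_le_card (R := ℝ) ({y} : Set (Input d))
    rw [h, finrank_top, finrank_euclideanSpace_fin] at h₁
    simp at h₁
    omega

/-- The measure of a spherical cap decays like a Gaussian tail: the cone over the cap of height `t`
around `u` is contained in the ball of radius `√(1 - t ^ 2)` around `t • u`. -/
theorem uniformSphere_cap_le {d : ℕ} (hd : d ≠ 0) {u : Input d} (hu : ‖u‖ = 1) {t : ℝ}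
    (ht₀ : 0 < t) (ht : t ^ 2 ≤ 1 / 2) :
    uniformSphere d {x | t < inner ℝ u x} ≤ ENNReal.ofReal (Real.exp (-(d * t ^ 2 / 2))) := by
  have : NeZero d := ⟨hd⟩
  have hmeas : MeasurableSet {x : Input d | t < inner ℝ u x} :=
    measurableSet_lt measurable_const (by fun_prop)
  refine uniformSphere_le_of_cone_subset (B := Metric.ball (t • u) √(1 - t ^ 2)) hd hmeas ?_ ?_
  · rintro r ⟨hr₀, hr₁⟩ x hx hx₁
    rw [Set.mem_ofPred_eq] at hx
    rw [Metric.mem_ball, dist_eq_norm]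
    refine Real.lt_sqrt_of_sq_lt ?_
    rw [norm_sub_sq_real, norm_smul, norm_smul, hx₁, hu, real_inner_smul_left,
      real_inner_smul_right, real_inner_comm, mul_one, mul_one, Real.norm_eq_abs,
      Real.norm_eq_abs, sq_abs, sq_abs]
    -- The left side is a convex function of `r`, with values `t ^ 2` and `1 - t ^ 2` at the ends.
    have h₁ : r * (t * t) < r * (t * inner ℝ u x) := by gcongr
    nlinarith [mul_pos hr₀ (sub_pos.2 hr₁)]
  · rw [Measure.addHaar_ball _ _ (Real.sqrt_nonneg _), finrank_euclideanSpace_fin]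
    refine mul_le_mul_left (ENNReal.ofReal_le_ofReal ?_) _
    have h₁ : √(1 - t ^ 2) ≤ Real.exp (-(t ^ 2 / 2)) := by
      refine Real.sqrt_le_iff.2 ⟨(Real.exp_pos _).le, ?_⟩
      rw [← Real.exp_nat_mul]
      refine le_trans (by linarith [Real.add_one_le_exp (-t ^ 2)]) (Real.exp_le_exp.2 (le_of_eq ?_))
        (b := Real.exp (-t ^ 2))
      push_cast
      ring
    refine (pow_le_pow_left₀ (Real.sqrt_nonneg _) h₁ d).trans (le_of_eq ?_)
    rw [← Real.exp_nat_mul]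
    congr 1
    ring

theorem uniformSphere_abs_inner_gt_le {d : ℕ} (hd : d ≠ 0) {u : Input d} (hu : ‖u‖ = 1) {t : ℝ}
    (ht₀ : 0 < t) (ht : t ^ 2 ≤ 1 / 2) :
    uniformSphere d {x | t < |inner ℝ u x|}
      ≤ ENNReal.ofReal (2 * Real.exp (-(d * t ^ 2 / 2))) := by
  have h : {x : Input d | t < |inner ℝ u x|}
      ⊆ {x | t < inner ℝ u x} ∪ {x | t < inner ℝ (-u) x} := by
    intro x hx
    simpa [lt_abs] using hx
  rw [two_mul, ENNReal.ofReal_add (Real.exp_pos _).le (Real.exp_pos _).le]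
  exact (measure_mono h).trans ((measure_union_le _ _).trans (add_le_add
    (uniformSphere_cap_le hd hu ht₀ ht) (uniformSphere_cap_le hd (by rwa [norm_neg]) ht₀ ht)))

/-! ### The law of the sample -/

theorem isProbabilityMeasure_noisyLabel {p : ℝ} (hp₀ : 0 ≤ p) (hp₁ : p ≤ 1) :
    IsProbabilityMeasure (noisyLabel p) := by
  refine ⟨?_⟩
  simp only [noisyLabel, Measure.add_apply, Measure.smul_apply, measure_univ, smul_eq_mul, mul_one]
  rw [← ENNReal.ofReal_add (by linarith) hp₀, sub_add_cancel, ENNReal.ofReal_one]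

theorem ae_noisyLabel (p : ℝ) : ∀ᵐ y ∂noisyLabel p, y = 1 ∨ y = -1 := by
  rw [noisyLabel, ae_add_measure_iff]
  exact ⟨Measure.ae_smul_measure (by simp) _, Measure.ae_smul_measure (by simp) _⟩

theorem noisyLabel_setOf_ne_one (p : ℝ) : noisyLabel p {y | y ≠ 1} = ENNReal.ofReal p := by
  have h : MeasurableSet {y : ℝ | y ≠ 1} := (measurableSet_singleton 1).compl
  rw [noisyLabel, Measure.add_apply, Measure.smul_apply, Measure.smul_apply,
    Measure.dirac_apply' _ h, Measure.dirac_apply' _ h]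
  norm_num [Set.indicator]

/-- The exponential moment of the indicator `(1 - y) / 2` of a noisy label. -/
theorem integral_exp_noisyLabel_le {p : ℝ} (hp₀ : 0 ≤ p) (hp₁ : p ≤ 1) :
    ∫ y, Real.exp ((1 - y) / 2) ∂noisyLabel p ≤ Real.exp (2 * p) := by
  have h : ∀ (a c : ℝ), Integrable (fun y ↦ Real.exp ((1 - y) / 2))
      (ENNReal.ofReal c • Measure.dirac a) := fun a c ↦
    (integrable_dirac (by simp)).smul_measure ENNReal.ofReal_ne_top
  rw [noisyLabel, integral_add_measure (h _ _) (h _ _), integral_smul_measure,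
    integral_smul_measure, integral_dirac, integral_dirac, ENNReal.toReal_ofReal (by linarith),
    ENNReal.toReal_ofReal hp₀]
  norm_num
  nlinarith [Real.add_one_le_exp (2 * p), Real.exp_one_lt_three]

section Sample

variable {d m : ℕ} {p : ℝ}

theorem isProbabilityMeasure_sampleLaw (m : ℕ) (hd : d ≠ 0) (hp₀ : 0 ≤ p) (hp₁ : p ≤ 1) :
    IsProbabilityMeasure (sampleLaw d m p) := by
  have := isProbabilityMeasure_uniformSphere hd
  have := isProbabilityMeasure_noisyLabel hp₀ hp₁
  rw [sampleLaw]
  infer_instance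

theorem ae_sampleLaw (m : ℕ) (hd : d ≠ 0) (hp₀ : 0 ≤ p) (hp₁ : p ≤ 1) :
    ∀ᵐ S ∂sampleLaw d m p, ∀ i, ‖(S i).1‖ = 1 ∧ ((S i).2 = 1 ∨ (S i).2 = -1) := by
  have := isProbabilityMeasure_uniformSphere hd
  have := isProbabilityMeasure_noisyLabel hp₀ hp₁
  rw [ae_all_iff]
  intro i
  refine (Measure.quasiMeasurePreserving_eval
    (fun _ : Fin m ↦ (uniformSphere d).prod (noisyLabel p)) i).ae
    (p := fun z ↦ ‖z.1‖ = 1 ∧ (z.2 = 1 ∨ z.2 = -1)) ?_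
  exact (Measure.quasiMeasurePreserving_fst.ae (ae_uniformSphere_norm_eq_one d)).and
    (Measure.quasiMeasurePreserving_snd.ae (ae_noisyLabel p))

theorem sampleLaw_label_ne_one (hd : d ≠ 0) (hp₀ : 0 ≤ p) (hp₁ : p ≤ 1) (i : Fin m) :
    sampleLaw d m p {S | (S i).2 ≠ 1} = ENNReal.ofReal p := by
  have := isProbabilityMeasure_uniformSphere hd
  have := isProbabilityMeasure_noisyLabel hp₀ hp₁
  have h := (measurePreserving_snd (μ := uniformSphere d) (ν := noisyLabel p)).comp
    (measurePreserving_eval (fun _ : Fin m ↦ (uniformSphere d).prod (noisyLabel p)) i)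
  rw [← noisyLabel_setOf_ne_one p]
  exact h.measure_preimage (s := {y | y ≠ 1})
    (measurableSet_singleton (1 : ℝ)).compl.nullMeasurableSet

/-- Two inputs of the sample are nearly orthogonal with high probability: conditionally on the
first one, this is the bound for spherical caps. -/
theorem sampleLaw_abs_inner_gt_le (hd : d ≠ 0) (hp₀ : 0 ≤ p) (hp₁ : p ≤ 1) {i j : Fin m}
    (hij : i ≠ j) {t : ℝ} (ht₀ : 0 < t) (ht : t ^ 2 ≤ 1 / 2) :
    sampleLaw d m p {S | t < |inner ℝ (S i).1 (S j).1|}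
      ≤ ENNReal.ofReal (2 * Real.exp (-(d * t ^ 2 / 2))) := by
  have := isProbabilityMeasure_uniformSphere hd
  have := isProbabilityMeasure_noisyLabel hp₀ hp₁
  have hinput : ∀ k : Fin m, Measurable fun S : Dataset d m ↦ (S k).1 := fun k ↦ by fun_prop
  have hfst : ∀ k : Fin m, (sampleLaw d m p).map (fun S ↦ (S k).1) = uniformSphere d := fun k ↦
    ((measurePreserving_fst (μ := uniformSphere d) (ν := noisyLabel p)).comp
      (measurePreserving_eval (fun _ : Fin m ↦ (uniformSphere d).prod (noisyLabel p)) k)).map_eq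
  have hind : ProbabilityTheory.iIndepFun (fun (k : Fin m) (S : Dataset d m) ↦ (S k).1)
      (sampleLaw d m p) :=
    ProbabilityTheory.iIndepFun_pi
      (μ := fun _ : Fin m ↦ (uniformSphere d).prod (noisyLabel p)) (X := fun _ z ↦ z.1)
      fun _ ↦ measurable_fst.aemeasurable
  have := isProbabilityMeasure_sampleLaw m hd hp₀ hp₁
  have hmap := (ProbabilityTheory.indepFun_iff_map_prod_eq_prod_map_map
    (hinput i).aemeasurable (hinput j).aemeasurable).1 (hind.indepFun hij)
  rw [hfst, hfst] at hmap
  have hmeas : MeasurableSet {z : Input d × Input d | t < |inner ℝ z.1 z.2|} :=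
    measurableSet_lt measurable_const (by fun_prop)
  have h₁ : sampleLaw d m p {S | t < |inner ℝ (S i).1 (S j).1|}
      = (uniformSphere d).prod (uniformSphere d)
        {z : Input d × Input d | t < |inner ℝ z.1 z.2|} := by
    rw [← hmap, Measure.map_apply ((hinput i).prodMk (hinput j)) hmeas]
    rfl
  rw [h₁, Measure.prod_apply hmeas]
  calc _ ≤ ∫⁻ _, ENNReal.ofReal (2 * Real.exp (-(d * t ^ 2 / 2))) ∂uniformSphere d := by
        refine lintegral_mono_ae ?_
        filter_upwards [ae_uniformSphere_norm_eq_one d] with u hu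
        exact uniformSphere_abs_inner_gt_le hd hu ht₀ ht
    _ = _ := by rw [lintegral_const, measure_univ, mul_one]

/-- A Chernoff bound for the number of labels `-1`. -/
theorem sampleLaw_count_gt_le (hd : d ≠ 0) (hp₀ : 0 ≤ p) (hp₁ : p ≤ 1) (K : ℝ) :
    sampleLaw d m p {S | K < ∑ i, (1 - (S i).2) / 2}
      ≤ ENNReal.ofReal (Real.exp (2 * p * m - K)) := by
  have := isProbabilityMeasure_uniformSphere hd
  have := isProbabilityMeasure_noisyLabel hp₀ hp₁
  have := isProbabilityMeasure_sampleLaw m hd hp₀ hp₁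
  set f : Input d × ℝ → ℝ := fun z ↦ Real.exp ((1 - z.2) / 2) with hf
  have hf₁ : Integrable f ((uniformSphere d).prod (noisyLabel p)) := by
    refine Integrable.comp_snd (f := fun y ↦ Real.exp ((1 - y) / 2)) ?_ _
    exact Integrable.add_measure
      ((integrable_dirac (by simp)).smul_measure ENNReal.ofReal_ne_top)
      ((integrable_dirac (by simp)).smul_measure ENNReal.ofReal_ne_top)
  have hprod : ∀ S : Dataset d m, ∏ i, f (S i) = Real.exp (∑ i, (1 - (S i).2) / 2) := fun S ↦
    (Real.exp_sum _ _).symm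
  have hint : Integrable (fun S : Dataset d m ↦ ∏ i, f (S i)) (sampleLaw d m p) :=
    Integrable.fintype_prod fun _ ↦ hf₁
  have hle : ∫ S, ∏ i, f (S i) ∂sampleLaw d m p ≤ Real.exp (2 * p * m) := by
    rw [sampleLaw, integral_fintype_prod_eq_prod (fun _ ↦ f), Finset.prod_const, Finset.card_univ,
      Fintype.card_fin, mul_comm, Real.exp_nat_mul]
    refine pow_le_pow_left₀ (integral_nonneg fun _ ↦ (Real.exp_pos _).le) ?_ _
    rw [hf, integral_fun_snd (fun y ↦ Real.exp ((1 - y) / 2))]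
    simpa using integral_exp_noisyLabel_le hp₀ hp₁
  have hmarkov := mul_meas_ge_le_integral_of_nonneg
    (Filter.Eventually.of_forall fun S ↦ Finset.prod_nonneg fun i _ ↦ (Real.exp_pos _).le)
    hint (Real.exp K)
  have hsub : {S : Dataset d m | K < ∑ i, (1 - (S i).2) / 2}
      ⊆ {S | Real.exp K ≤ ∏ i, f (S i)} := by
    intro S hS
    rw [Set.mem_ofPred_eq, hprod]
    exact Real.exp_le_exp.2 (le_of_lt hS)
  refine (measure_mono hsub).trans ?_
  rw [← ofReal_measureReal]
  refine ENNReal.ofReal_le_ofReal ?_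
  rw [Real.exp_sub, le_div_iff₀ (Real.exp_pos _), mul_comm]
  exact hmarkov.trans hle

end Sample

/-! ### The clean test error -/

namespace NetParams

variable {d n m : ℕ}

theorem IsKKT.cleanTestError_eq_zero [NeZero m] {S : Dataset d m} {θ : NetParams d n}
    (hθ : θ.IsKKT S) (hd : 2 ≤ d) (hS : ∀ i, ‖(S i).1‖ = 1) (hlabel : ∀ i, (S i).2 = 1) :
    θ.cleanTestError = 0 := by
  have h : ∀ᵐ x ∂uniformSphere d, x ∉ {x | θ.net x ≤ 0} := by
    have h₁ : ∀ᵐ x ∂uniformSphere d, ∀ i, x ≠ -(S i).1 := by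
      rw [ae_all_iff]
      intro i
      rw [ae_iff]
      simpa using uniformSphere_singleton hd (-(S i).1)
    filter_upwards [h₁, ae_uniformSphere_norm_eq_one d] with x hx hx₁
    simpa using hθ.net_pos_of_forall_label_eq_one hS hlabel hx₁ hx
  rw [cleanTestError, measureReal_def, measure_eq_zero_iff_ae_notMem.2 h, ENNReal.toReal_zero]

/-- A uniform point is nearly orthogonal to all inputs with high probability, by a union bound over
spherical caps. -/
theorem cleanTestError_le_of_forall_net_pos (hd : d ≠ 0) {x : Fin m → Input d}
    (hx : ∀ i, ‖x i‖ = 1) {t : ℝ} (ht₀ : 0 < t) (ht : t ^ 2 ≤ 1 / 2) {θ : NetParams d n}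
    (hθ : ∀ y, (∀ i, |inner ℝ (x i) y| ≤ t) → 0 < θ.net y) :
    θ.cleanTestError ≤ m * (2 * Real.exp (-(d * t ^ 2 / 2))) := by
  refine ENNReal.toReal_le_of_le_ofReal (by positivity) ?_
  have hsub : {y | θ.net y ≤ 0} ⊆ ⋃ i, {y | t < |inner ℝ (x i) y|} := by
    intro y hy
    by_contra h
    simp only [Set.mem_iUnion, Set.mem_ofPred_eq, not_exists, not_lt] at h hy
    exact (hθ y h).not_ge hy
  calc _ ≤ ∑ i, uniformSphere d {y | t < |inner ℝ (x i) y|} :=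
        (measure_mono hsub).trans (measure_iUnion_fintype_le _ _)
    _ ≤ ∑ _ : Fin m, ENNReal.ofReal (2 * Real.exp (-(d * t ^ 2 / 2))) :=
        Finset.sum_le_sum fun i _ ↦ uniformSphere_abs_inner_gt_le hd (hx i) ht₀ ht
    _ = _ := by
        rw [Finset.sum_const, Finset.card_univ, Fintype.card_fin, nsmul_eq_mul,
          ENNReal.ofReal_mul (Nat.cast_nonneg m), ENNReal.ofReal_natCast]

end NetParams

/-! ### The two regimes of the noise level -/

theorem ofReal_one_sub_le_of_measure_compl_le {Ω : Type*} [MeasurableSpace Ω] {μ : Measure Ω}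
    [IsProbabilityMeasure μ] {E : Set Ω} {δ : ℝ} (hδ : 0 ≤ δ) (h : μ Eᶜ ≤ ENNReal.ofReal δ) :
    ENNReal.ofReal (1 - δ) ≤ μ E := by
  rw [ENNReal.ofReal_sub _ hδ, ENNReal.ofReal_one, tsub_le_iff_right, ← measure_univ (μ := μ),
    ← Set.union_compl_self E]
  exact (measure_union_le _ _).trans (add_le_add_right h _)

section Regimes

variable {ε δ p : ℝ} {m d n : ℕ}

/-- When the expected number of noisy labels is below `δ`, with probability `1 - δ` there are none
at all. -/
theorem exists_event_of_mul_le [NeZero m] (hε : 0 ≤ ε) (hδ : 0 ≤ δ) (hp₀ : 0 ≤ p) (hp₁ : p ≤ 1)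
    (hd : 2 ≤ d) (hmp : m * p ≤ δ) :
    ∃ E : Set (Dataset d m), MeasurableSet E ∧ ENNReal.ofReal (1 - δ) ≤ sampleLaw d m p E ∧
      ∀ S ∈ E, ∀ θ : NetParams d n, θ.IsKKT S → θ.cleanTestError ≤ ε := by
  have hd₀ : d ≠ 0 := by omega
  have := isProbabilityMeasure_sampleLaw m hd₀ hp₀ hp₁
  refine ⟨{S | ∀ i, ‖(S i).1‖ = 1 ∧ (S i).2 = 1}, ?_, ?_, ?_⟩
  · have h : ∀ i, MeasurableSet {S : Dataset d m | ‖(S i).1‖ = 1 ∧ (S i).2 = 1} := fun i ↦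
      (measurableSet_eq_fun (by fun_prop) measurable_const).inter
        (measurableSet_eq_fun (by fun_prop) measurable_const)
    simpa only [Set.ofPred_forall] using MeasurableSet.iInter h
  · refine ofReal_one_sub_le_of_measure_compl_le hδ ?_
    calc _ ≤ sampleLaw d m p (⋃ i, {S | (S i).2 ≠ 1}) := by
          refine measure_mono_ae ?_
          filter_upwards [ae_sampleLaw m hd₀ hp₀ hp₁] with S hS hSE
          by_contra h
          refine hSE fun i ↦ ⟨(hS i).1, ?_⟩
          by_contra hi
          exact h (Set.mem_iUnion.2 ⟨i, hi⟩)
      _ ≤ ∑ i, sampleLaw d m p {S | (S i).2 ≠ 1} := measure_iUnion_fintype_le _ _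
      _ = ENNReal.ofReal (m * p) := by
          simp only [sampleLaw_label_ne_one hd₀ hp₀ hp₁, Finset.sum_const, Finset.card_univ,
            Fintype.card_fin, nsmul_eq_mul]
          rw [ENNReal.ofReal_mul (Nat.cast_nonneg m), ENNReal.ofReal_natCast]
      _ ≤ _ := ENNReal.ofReal_le_ofReal hmp
  · intro S hS θ hθ
    rw [hθ.cleanTestError_eq_zero hd (fun i ↦ (hS i).1) fun i ↦ (hS i).2]
    exact hε

/-- The sample is nearly orthogonal and has at most `K` labels `-1`, up to the failure
probabilities of a union bound over pairs and of a Chernoff bound. -/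
theorem exists_event_nearlyOrthogonal (hd : d ≠ 0) (hδ : 0 ≤ δ) (hp₀ : 0 ≤ p) (hp₁ : p ≤ 1)
    {t K : ℝ} (ht₀ : 0 < t) (ht : t ^ 2 ≤ 1 / 2)
    (hpair : m * (m * (2 * Real.exp (-(d * t ^ 2 / 2)))) ≤ δ / 2)
    (hcount : Real.exp (2 * p * m - K) ≤ δ / 2) :
    ∃ E : Set (Dataset d m), MeasurableSet E ∧ ENNReal.ofReal (1 - δ) ≤ sampleLaw d m p E ∧
      ∀ S ∈ E, (∀ i, ‖(S i).1‖ = 1) ∧ (∀ i, (S i).2 = 1 ∨ (S i).2 = -1) ∧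
        (∀ i j, i ≠ j → |inner ℝ (S i).1 (S j).1| ≤ t) ∧ ∑ i, (1 - (S i).2) / 2 ≤ K := by
  have := isProbabilityMeasure_sampleLaw m hd hp₀ hp₁
  set A : Set (Dataset d m) := {S | ∀ i, ‖(S i).1‖ = 1 ∧ ((S i).2 = 1 ∨ (S i).2 = -1)}
  set B : Set (Dataset d m) := ⋃ i, ⋃ j, {S | i ≠ j ∧ t < |inner ℝ (S i).1 (S j).1|}
  set C : Set (Dataset d m) := {S | K < ∑ i, (1 - (S i).2) / 2}
  have hA : MeasurableSet A := by
    have h : ∀ i, MeasurableSet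
        {S : Dataset d m | ‖(S i).1‖ = 1 ∧ ((S i).2 = 1 ∨ (S i).2 = -1)} := fun i ↦
      (measurableSet_eq_fun (by fun_prop) measurable_const).inter
        ((measurableSet_eq_fun (by fun_prop) measurable_const).union
          (measurableSet_eq_fun (by fun_prop) measurable_const))
    simpa only [A, Set.ofPred_forall] using MeasurableSet.iInter h
  have hB : MeasurableSet B := by
    refine MeasurableSet.iUnion fun i ↦ MeasurableSet.iUnion fun j ↦ ?_
    have h : Measurable fun S : Dataset d m ↦ |inner ℝ (S i).1 (S j).1| := by fun_prop
    exact (MeasurableSet.const _).inter (measurableSet_lt measurable_const h)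
  have hC : MeasurableSet C := by
    have h : Measurable fun S : Dataset d m ↦ ∑ i, (1 - (S i).2) / 2 :=
      Finset.measurable_sum _ fun i _ ↦ by fun_prop
    exact measurableSet_lt measurable_const h
  have hBle : sampleLaw d m p B ≤ ENNReal.ofReal (δ / 2) := by
    calc sampleLaw d m p B
        ≤ ∑ i : Fin m, ∑ j : Fin m,
          sampleLaw d m p {S | i ≠ j ∧ t < |inner ℝ (S i).1 (S j).1|} :=
          (measure_iUnion_fintype_le _ _).trans
            (Finset.sum_le_sum fun i _ ↦ measure_iUnion_fintype_le _ _)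
      _ ≤ ∑ _ : Fin m, ∑ _ : Fin m, ENNReal.ofReal (2 * Real.exp (-(d * t ^ 2 / 2))) := by
          refine Finset.sum_le_sum fun i _ ↦ Finset.sum_le_sum fun j _ ↦ ?_
          by_cases hij : i = j
          · simp [hij]
          · exact (measure_mono fun S hS ↦ hS.2).trans
              (sampleLaw_abs_inner_gt_le hd hp₀ hp₁ hij ht₀ ht)
      _ = ENNReal.ofReal (m * (m * (2 * Real.exp (-(d * t ^ 2 / 2))))) := by
          simp only [Finset.sum_const, Finset.card_univ, Fintype.card_fin, nsmul_eq_mul]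
          rw [ENNReal.ofReal_mul (Nat.cast_nonneg m), ENNReal.ofReal_mul (Nat.cast_nonneg m),
            ENNReal.ofReal_natCast]
      _ ≤ _ := ENNReal.ofReal_le_ofReal hpair
  refine ⟨A \ (B ∪ C), hA.diff (hB.union hC), ?_, ?_⟩
  · refine ofReal_one_sub_le_of_measure_compl_le hδ ?_
    calc _ ≤ sampleLaw d m p (B ∪ C) := by
          refine measure_mono_ae ?_
          filter_upwards [ae_sampleLaw m hd hp₀ hp₁] with S hS hSE
          by_contra h
          exact hSE ⟨hS, h⟩
      _ ≤ ENNReal.ofReal (δ / 2) + ENNReal.ofReal (δ / 2) :=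
          (measure_union_le _ _).trans (add_le_add hBle
            ((sampleLaw_count_gt_le hd hp₀ hp₁ K).trans (ENNReal.ofReal_le_ofReal hcount)))
      _ = ENNReal.ofReal δ := by
          rw [← ENNReal.ofReal_add (by linarith) (by linarith), add_halves]
  · rintro S ⟨hSA, hS⟩
    refine ⟨fun i ↦ (hSA i).1, fun i ↦ (hSA i).2, fun i j hij ↦ ?_, ?_⟩
    · by_contra! h
      exact hS (Or.inl (Set.mem_iUnion.2 ⟨i, Set.mem_iUnion.2 ⟨j, hij, h⟩⟩))
    · by_contra! h
      exact hS (Or.inr h)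

/-- When the expected number of noisy labels is not small, it is concentrated, and a KKT point with
squared norm within a factor `1 / (1000 √p)` of the optimum is too small to fit the clean labels
without a positive value at the origin. -/
theorem exists_event_of_half_le_mul (hε : 0 < ε) (hε₁ : ε < 1) (hδ : 0 < δ) (hδ₁ : δ < 1)
    (hp₀ : 0 < p) (hp₁ : p ≤ 1 / 50) (hd : 2 ≤ d) (hmp : 1 / 2 ≤ m * p)
    (hmδ : Real.log (1 / δ) ≤ m * p)
    (hdm : 200 * (m : ℝ) ^ 2 * Real.log (m / ε) * Real.log (m / δ) ≤ d) :
    ∃ E : Set (Dataset d m), MeasurableSet E ∧ ENNReal.ofReal (1 - δ) ≤ sampleLaw d m p E ∧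
      ∀ S ∈ E, ∀ θ θopt : NetParams d n, θ.IsKKT S → θopt.IsMaxMargin S →
        θ.normSq ≤ 1 / 1000 / √p * θopt.normSq → θ.cleanTestError ≤ ε := by
  have hd₀ : d ≠ 0 := by omega
  have hm : (25 : ℝ) ≤ m := by nlinarith [Nat.cast_nonneg (α := ℝ) m]
  have hm₀ : (0 : ℝ) < m := by linarith
  have : NeZero m := ⟨by rintro rfl; norm_num at hm⟩
  have hlog : ∀ a : ℝ, 0 < a → a < 1 → 0.69 ≤ Real.log (m / a) := by
    intro a ha ha₁
    refine le_trans (by linarith [Real.log_two_gt_d9]) (Real.log_le_log two_pos (?_ : 2 ≤ m / a))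
    rw [le_div_iff₀ ha]
    nlinarith
  have hL := hlog ε hε hε₁
  have hM := hlog δ hδ hδ₁
  have hexp : ∀ a : ℝ, 0 < a → ∀ k : ℕ, Real.exp (-(k * Real.log (m / a))) = (a / m) ^ k := by
    intro a ha k
    rw [← mul_neg, Real.exp_nat_mul, Real.exp_neg, Real.exp_log (by positivity), inv_div]
  have hpair : (m : ℝ) * (m * (2 * Real.exp (-(d * (1 / (4 * m)) ^ 2 / 2)))) ≤ δ / 2 := by
    have h₁ : Real.exp (-(d * (1 / (4 * m)) ^ 2 / 2)) ≤ (δ / m) ^ 4 := by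
      rw [← hexp δ hδ 4]
      refine Real.exp_le_exp.2 (neg_le_neg ?_)
      have h₂ : (d : ℝ) * (1 / (4 * m)) ^ 2 / 2 = d / (32 * m ^ 2) := by field_simp; norm_num
      rw [h₂, le_div_iff₀ (by positivity)]
      refine le_trans ?_ hdm
      have := mul_le_mul_of_nonneg_right hL (show 0 ≤ Real.log (m / δ) by linarith)
      push_cast
      nlinarith [sq_nonneg (m : ℝ)]
    calc _ ≤ (m : ℝ) * (m * (2 * (δ / m) ^ 4)) := by gcongr
      _ = δ * δ ^ 3 * (2 / m ^ 2) := by field_simp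
      _ ≤ δ * 1 * (1 / 2) := by
          have h₂ : (2 : ℝ) / m ^ 2 ≤ 1 / 2 := by
            rw [div_le_iff₀ (by positivity)]
            nlinarith
          exact mul_le_mul (mul_le_mul_of_nonneg_left (pow_le_one₀ hδ.le hδ₁.le) hδ.le) h₂
            (by positivity) (by positivity)
      _ = δ / 2 := by ring
  have hcount : Real.exp (2 * p * m - 5 * p * m) ≤ δ / 2 := by
    have h₁ : Real.exp (-(m * p)) ≤ δ := by
      rw [← Real.exp_log hδ]
      rw [one_div, Real.log_inv] at hmδ
      exact Real.exp_le_exp.2 (by linarith)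
    have h₂ : Real.exp (-1) ≤ 1 / 2 := by
      linarith [Real.exp_neg_one_lt_d9]
    calc Real.exp (2 * p * m - 5 * p * m) ≤ Real.exp (-(m * p) + -1) :=
          Real.exp_le_exp.2 (by linarith)
      _ = Real.exp (-(m * p)) * Real.exp (-1) := Real.exp_add _ _
      _ ≤ δ * (1 / 2) := mul_le_mul h₁ h₂ (Real.exp_pos _).le hδ.le
      _ = δ / 2 := by ring
  have ht : ((1 : ℝ) / m) ^ 2 ≤ 1 / 2 := by
    rw [div_pow, one_pow]
    exact one_div_le_one_div_of_le two_pos (by nlinarith)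
  have htest : (m : ℝ) * (2 * Real.exp (-(d * (1 / m) ^ 2 / 2))) ≤ ε := by
    have h₁ : Real.exp (-(d * (1 / m) ^ 2 / 2)) ≤ (ε / m) ^ 2 := by
      rw [← hexp ε hε 2]
      refine Real.exp_le_exp.2 (neg_le_neg ?_)
      have h₂ : (d : ℝ) * (1 / m) ^ 2 / 2 = d / (2 * m ^ 2) := by field_simp
      rw [h₂, le_div_iff₀ (by positivity)]
      refine le_trans ?_ hdm
      have := mul_le_mul_of_nonneg_left hM (show 0 ≤ Real.log (m / ε) by linarith)
      push_cast
      nlinarith [sq_nonneg (m : ℝ)]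
    calc _ ≤ (m : ℝ) * (2 * (ε / m) ^ 2) := by gcongr
      _ = ε * (2 * ε / m) := by field_simp
      _ ≤ ε * 1 := by
          gcongr
          rw [div_le_iff₀ hm₀]
          linarith
      _ = ε := mul_one ε
  obtain ⟨E, hE, hμE, hSE⟩ := exists_event_nearlyOrthogonal (m := m) hd₀ hδ.le hp₀.le
    (by linarith) (t := 1 / (4 * m)) (K := 5 * p * m) (by positivity)
    (le_trans (pow_le_pow_left₀ (by positivity)
      (one_div_le_one_div_of_le hm₀ (by linarith)) 2) ht) hpair hcount
  refine ⟨E, hE, hμE, fun S hS θ θopt hθ hopt hnorm ↦ ?_⟩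
  obtain ⟨hunit, hlabel, hinner, hK⟩ := hSE S hS
  by_cases hneg : ∃ i, (S i).2 = -1
  · have hhalf : ∑ i, (1 - (S i).2) / 2 ≤ (m : ℝ) / 2 := by nlinarith
    have hpos : ∃ i, (S i).2 = 1 := by
      by_contra! h
      have h₁ : ∀ i, (S i).2 = -1 := fun i ↦ (hlabel i).resolve_left (h i)
      simp only [h₁, Finset.sum_const, Finset.card_univ, Fintype.card_fin, nsmul_eq_mul] at hhalf
      linarith
    have hopt' := hopt.normSq_le hunit hlabel hinner hK hpos hneg
    have hsmall : θ.normSq ≤ √m / 8 := by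
      have h₁ : √(5 * p * m) ≤ 2.3 * √p * √m := by
        rw [Real.sqrt_mul (by positivity), Real.sqrt_mul (by norm_num)]
        gcongr
        exact Real.sqrt_le_iff.2 ⟨by norm_num, by norm_num⟩
      have hsp : 0 < √p := Real.sqrt_pos.2 hp₀
      calc θ.normSq ≤ 1 / 1000 / √p * θopt.normSq := hnorm
        _ ≤ 1 / 1000 / √p * (53 * (2.3 * √p * √m)) :=
            mul_le_mul_of_nonneg_left (hopt'.trans (by linarith)) (by positivity)
        _ = 0.1219 * √m := by field_simp; norm_num
        _ ≤ √m / 8 := by linarith [Real.sqrt_nonneg (m : ℝ)]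
    exact (NetParams.cleanTestError_le_of_forall_net_pos hd₀ hunit (by positivity) ht fun y hy ↦
      hθ.net_pos_of_normSq_le hunit hlabel hinner hhalf hsmall hy).trans htest
  · push Not at hneg
    rw [hθ.cleanTestError_eq_zero hd hunit fun i ↦ (hlabel i).resolve_right (hneg i)]
    exact hε.le

end Regimes

theorem theorem4 :
    ∃ c₁ c₂ c₃ c₄ : ℝ, 0 < c₁ ∧ 0 < c₂ ∧ 0 < c₃ ∧ 0 < c₄ ∧
      ∀ (ε δ p : ℝ) (m d n : ℕ), 0 < ε → 0 < δ → 0 < p → 2 ≤ d →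
        p ≤ c₁ →
        c₂ * (Real.log (1 / δ) / p) ≤ (m : ℝ) →
        c₃ * (m : ℝ) ^ 2 * Real.log (m / ε) * Real.log (m / δ) ≤ (d : ℝ) →
        ∃ E : Set (Dataset d m), MeasurableSet E ∧
          ENNReal.ofReal (1 - δ) ≤ sampleLaw d m p E ∧
          ∀ S ∈ E, ∀ θ θopt : NetParams d n,
            θ.IsKKT S → θopt.IsMaxMargin S →
            θ.normSq ≤ c₄ / Real.sqrt p * θopt.normSq →
            θ.cleanTestError ≤ ε := by
  refine ⟨1 / 50, 1, 200, 1 / 1000, by norm_num, by norm_num, by norm_num, by norm_num, ?_⟩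
  intro ε δ p m d n hε hδ hp hd hp₁ hm hdm
  have hd₀ : d ≠ 0 := by omega
  rcases le_or_gt 1 δ with hδ₁ | hδ₁
  · exact ⟨∅, MeasurableSet.empty, by simp [ENNReal.ofReal_of_nonpos (sub_nonpos.2 hδ₁)],
      fun S hS ↦ hS.elim⟩
  rcases le_or_gt 1 ε with hε₁ | hε₁
  · have := isProbabilityMeasure_uniformSphere hd₀
    have := isProbabilityMeasure_sampleLaw m hd₀ hp.le (by linarith)
    refine ⟨Set.univ, .univ, ?_, fun S _ θ _ _ _ _ ↦ measureReal_le_one.trans hε₁⟩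
    rw [measure_univ]
    exact ENNReal.ofReal_le_one.2 (by linarith)
  rw [one_mul, div_le_iff₀ hp] at hm
  have hlog : 0 < Real.log (1 / δ) := Real.log_pos ((one_lt_div hδ).2 hδ₁)
  have : NeZero m := ⟨by rintro rfl; rw [Nat.cast_zero, zero_mul] at hm; linarith⟩
  rcases le_or_gt (m * p) δ with hmp | hmp
  · obtain ⟨E, hE, hμE, h⟩ := exists_event_of_mul_le (n := n) hε.le hδ.le hp.le (by linarith) hd hmp
    exact ⟨E, hE, hμE, fun S hS θ _ hθ _ _ ↦ h S hS θ hθ⟩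
  · refine exists_event_of_half_le_mul hε hε₁ hδ hδ₁ hp hp₁ hd ?_ hm hdm
    -- As `1 - m * p ≤ exp (-(m * p)) ≤ δ < m * p`, the mean number of noisy labels exceeds `1 / 2`.
    have h₁ := Real.one_sub_inv_le_log_of_pos hδ
    rw [one_div, Real.log_inv] at hm
    have h₂ := Real.add_one_le_exp (Real.log δ)
    rw [Real.exp_log hδ] at h₂
    linarith
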